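/- All semigroups here are finite. The length $l(S)$ of a finite semigroup $S$ is the largest number of non-empty subsemigroups of $S$ in a chain (with respect to inclusion), minus $1$; so $l(\emptyset)=-1$. A subgroup of $S$ is a subsemigroup which is a group under the multiplication of $S$, and a maximal subgroup is a subgroup that is maximal under inclusion among the subgroups of $S$. The semigroup $S$ is completely regular if every element of $S$ belongs to a subgroup of $S$, and is a band if $x^2=x$ for all $x\in S$. The $\mathscr{L}$-, $\mathscr{R}$- and $\mathscr{J}$-classes of $S$ are the classes of elements generating the same principal left ideal $\{x\}\cup Sx$, principal right ideal $\{x\}\cup xS$, and principal two-sided ideal $\{x\}\cup Sx\cup xS\cup SxS$, respectively. Theorem. Let $S$ be a finite completely regular semigroup with $m$ $\mathscr{L}$-classes and $n$ $\mathscr{R}$-classes, let $J_1,\ldots,J_r$ be the (distinct) $\mathscr{J}$-classes of $S$, and for each $i$ let $G_i$ be any maximal subgroup of $S$ contained in $J_i$. Then $$l(S)=m+n-r-1+\sum_{i=1}^{r} l(G_i).$$ In particular, if $S$ is a finite band with $m$ $\mathscr{L}$-classes, $n$ $\mathscr{R}$-classes and $r$ $\mathscr{J}$-classes, then $l(S)=m+n-r-1$.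 -/

import Mathlib

namespace FiniteSemigroup

/-- The sizes of the finite chains (with respect to inclusion) of non-empty subsemigroups of `S`. -/
def chainSizes (S : Type*) [Semigroup S] : Set ℕ :=
  {k | ∃ C : Finset (Subsemigroup S),
    (∀ T ∈ C, (T : Set S).Nonempty) ∧
    IsChain (· ≤ ·) (C : Set (Subsemigroup S)) ∧ C.card = k}

/-- The length of a semigroup: the largest number of non-empty subsemigroups in a chain, minus `1`.
It is used for finite semigroups only, where the supremum is attained (see
`isGreatest_chainSizes`). It is an integer because the empty semigroup has length `-1`. -/
noncomputable def length (S : Type*) [Semigroup S] : ℤ :=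
  ((sSup (chainSizes S) : ℕ) : ℤ) - 1

/-- For a finite semigroup the supremum in the definition of `length` is a maximum. -/
theorem isGreatest_chainSizes (S : Type*) [Semigroup S] [Finite S] :
    IsGreatest (chainSizes S) (sSup (chainSizes S)) := by
  have hfin : Finite (Subsemigroup S) :=
    Finite.of_injective (fun T : Subsemigroup S => (T : Set S)) SetLike.coe_injective
  have := Fintype.ofFinite (Subsemigroup S)
  have hb : BddAbove (chainSizes S) := by
    refine ⟨Fintype.card (Subsemigroup S), ?_⟩
    rintro k ⟨C, -, -, rfl⟩
    exact Finset.card_le_univ C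
  have hne : (chainSizes S).Nonempty := ⟨0, ∅, by simp, by simp, by simp⟩
  exact ⟨Nat.sSup_mem hne hb, fun k hk => le_csSup hb hk⟩

/-- The principal left ideal `S¹x = {x} ∪ Sx`. -/
def leftIdeal {S : Type*} [Semigroup S] (x : S) : Set S :=
  {z | z = x ∨ ∃ s, z = s * x}

/-- The principal right ideal `xS¹ = {x} ∪ xS`. -/
def rightIdeal {S : Type*} [Semigroup S] (x : S) : Set S :=
  {z | z = x ∨ ∃ s, z = x * s}

/-- The principal two-sided ideal `S¹xS¹ = {x} ∪ Sx ∪ xS ∪ SxS`. -/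
def twoSidedIdeal {S : Type*} [Semigroup S] (x : S) : Set S :=
  {z | z = x ∨ (∃ s, z = s * x) ∨ (∃ t, z = x * t) ∨ ∃ s t, z = s * x * t}

/-- Green's `L`-relation: `S¹x = S¹y`. -/
def greenL (S : Type*) [Semigroup S] : Setoid S := Setoid.ker leftIdeal

/-- Green's `R`-relation: `xS¹ = yS¹`. -/
def greenR (S : Type*) [Semigroup S] : Setoid S := Setoid.ker rightIdeal

/-- Green's `J`-relation: `S¹xS¹ = S¹yS¹`. -/
def greenJ (S : Type*) [Semigroup S] : Setoid S := Setoid.ker twoSidedIdeal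

/-- A subsemigroup of `S` is a subgroup if it is a group under the multiplication of `S` (its
identity `e` need not be an identity of `S`). -/
def IsSubgroup {S : Type*} [Semigroup S] (G : Subsemigroup S) : Prop :=
  ∃ e ∈ G, (∀ x ∈ G, e * x = x ∧ x * e = x) ∧ ∀ x ∈ G, ∃ y ∈ G, x * y = e ∧ y * x = e

/-- A maximal subgroup of `S`: a subgroup that is maximal under inclusion among the subgroups. -/
def IsMaximalSubgroup {S : Type*} [Semigroup S] (G : Subsemigroup S) : Prop :=
  Maximal IsSubgroup G

/-- A semigroup is completely regular if every element belongs to a subgroup. -/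
def IsCompletelyRegular (S : Type*) [Semigroup S] : Prop :=
  ∀ x : S, ∃ G : Subsemigroup S, IsSubgroup G ∧ x ∈ G

/-- A band is a semigroup in which every element is idempotent. -/
def IsBand (S : Type*) [Semigroup S] : Prop :=
  ∀ x : S, IsIdempotentElem x

end FiniteSemigroup

/-! Counting the empty subsemigroup as bottom, `length S + 1` is the height of `⊤` in the lattice of
subsemigroups, so the formula splits into an upper and a lower bound for that height. Upper bound:
to `T` attach, for each J-class, the number of L-classes met minus 1, the number of R-classes met
minus 1, and the largest height of `T ⊓ H` over the H-classes `H` there. The sum strictly increases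
with `T` (`rank_lt`): an element x new to `T` either meets a new L- or R-class, or can be carried by
multipliers from `T` into any H-class of its J-class that `T` meets (`inf_hClass_lt`). Lower bound:
inside a J-class, first climb through one H-class, then add the L-classes one by one, then the
R-classes; each rectangle is a subsemigroup by `green_mul`. The J-classes are stacked along ideals
(`sum_natHeight_le_of_lower`). All H-classes of a J-class have equal height (`natHeight_hClass_eq`),
and the maximal subgroups are H-classes, so each J-class contributes its numbers of L- and
R-classes, minus 2, plus `length G + 1`. -/

namespace FiniteSemigroup

/-! ### Heights in finite partial orders -/

section Height

variable {α β : Type*} [PartialOrder α] [Finite α] [PartialOrder β] [Finite β]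

/-- The height of an element of a finite partial order, as a natural number. -/
noncomputable def natHeight (a : α) : ℕ := (Order.height a).toNat

theorem height_lt_top (a : α) : Order.height a < ⊤ := by
  have := Fintype.ofFinite α
  refine lt_of_le_of_lt (Order.height_le (n := (Fintype.card α : ℕ)) fun p _ => ?_)
    (ENat.natCast_lt_top _)
  exact_mod_cast p.length_lt_card.le

theorem coe_natHeight (a : α) : ((natHeight a : ℕ) : ℕ∞) = Order.height a :=
  ENat.natCast_toNat (height_lt_top a).ne

theorem natHeight_strictMono : StrictMono (natHeight : α → ℕ) := fun a b h => by
  have := Order.height_strictMono h (height_lt_top a)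
  rw [← coe_natHeight, ← coe_natHeight] at this
  exact_mod_cast this

theorem exists_lt_natHeight_eq {a : α} {n : ℕ} (h : natHeight a = n + 1) :
    ∃ b < a, natHeight b = n := by
  have h1 : (n : ℕ∞) < Order.height a := by
    rw [← coe_natHeight, h]; exact_mod_cast Nat.lt_succ_self n
  obtain ⟨b, hb, hbn⟩ := (Order.coe_lt_height_iff (height_lt_top a)).1 h1
  exact ⟨b, hb, by simp [natHeight, hbn]⟩

/-- Along a chain below `a` the value of `f` grows by at least 1 at each step; this gives the upper
bound on length. -/
theorem natHeight_le_of_strictMonoOn {f : α → ℕ} {a : α} (hf : StrictMonoOn f (Set.Iic a)) :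
    natHeight a ≤ f a := by
  have key : ∀ n, ∀ b ≤ a, natHeight b = n → n ≤ f b := by
    intro n
    induction n with
    | zero => intros; exact Nat.zero_le _
    | succ n ih =>
      intro b hb h
      obtain ⟨c, hc, hcn⟩ := exists_lt_natHeight_eq h
      have h1 := ih c (hc.le.trans hb) hcn
      have h2 := hf (hc.le.trans hb) hb hc
      omega
  exact key _ a le_rfl rfl

theorem natHeight_bot {α : Type*} [PartialOrder α] [OrderBot α] : natHeight (⊥ : α) = 0 := by simp [natHeight]

/-- A chain below `f ⊥` can be continued by the image of a chain below `a`; this is how J-classes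
are stacked. -/
theorem natHeight_add_le [OrderBot α] {f : α → β} {a : α} (hf : StrictMonoOn f (Set.Iic a)) :
    natHeight (f ⊥) + natHeight a ≤ natHeight (f a) := by
  have h : natHeight a ≤ natHeight (f a) - natHeight (f ⊥) := by
    refine natHeight_le_of_strictMonoOn (f := fun b => natHeight (f b) - natHeight (f ⊥)) ?_
    intro b hb c hc hbc
    have h1 := natHeight_strictMono (hf hb hc hbc)
    have h2 : natHeight (f ⊥) ≤ natHeight (f b) :=
      natHeight_strictMono.monotone (hf.monotoneOn bot_le hb bot_le)
    show _ - _ < _ - _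
    omega
  have h2 : natHeight (f ⊥) ≤ natHeight (f a) :=
    natHeight_strictMono.monotone (hf.monotoneOn bot_le (Set.mem_Iic.2 le_rfl) bot_le)
  omega

theorem natHeight_le_natHeight_apply [OrderBot α] {f : α → β} {a : α}
    (hf : StrictMonoOn f (Set.Iic a)) : natHeight a ≤ natHeight (f a) :=
  le_trans (Nat.le_add_left _ _) (natHeight_add_le hf)

theorem card_le_natHeight [OrderBot α] {C : Finset α} {a : α} (hC : IsChain (· ≤ ·) (C : Set α))
    (hbot : ⊥ ∉ C) (ha : ∀ b ∈ C, b ≤ a) : C.card ≤ natHeight a := by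
  have hmap : ∀ b ∈ C, natHeight b ∈ Finset.Icc 1 (natHeight a) := by
    intro b hb
    have h1 : (⊥ : α) < b := bot_lt_iff_ne_bot.2 fun h => hbot (h ▸ hb)
    have h2 := natHeight_strictMono h1
    exact Finset.mem_Icc.2 ⟨by omega, natHeight_strictMono.monotone (ha b hb)⟩
  have hinj : Set.InjOn natHeight (C : Set α) := by
    intro b hb c hc h
    by_contra hne
    rcases hC hb hc hne with hle | hle
    · exact (natHeight_strictMono (lt_of_le_of_ne hle hne)).ne h
    · exact (natHeight_strictMono (lt_of_le_of_ne hle (Ne.symm hne))).ne h.symm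
  simpa using Finset.card_le_card_of_injOn natHeight hmap hinj

theorem exists_chain_card_eq_natHeight [OrderBot α] (a : α) :
    ∃ C : Finset α, IsChain (· ≤ ·) (C : Set α) ∧ ⊥ ∉ C ∧ (∀ b ∈ C, b ≤ a) ∧
      C.card = natHeight a := by
  classical
  have key : ∀ n, ∀ a : α, natHeight a = n → ∃ C : Finset α, IsChain (· ≤ ·) (C : Set α) ∧
      ⊥ ∉ C ∧ (∀ b ∈ C, b ≤ a) ∧ C.card = n := by
    intro n
    induction n with
    | zero => intro a _; exact ⟨∅, by simp, by simp, by simp, rfl⟩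
    | succ n ih =>
      intro a h
      obtain ⟨b, hb, hbn⟩ := exists_lt_natHeight_eq h
      obtain ⟨C, hC, hbot, hle, hcard⟩ := ih b hbn
      have haC : a ∉ C := fun h' => (hle a h').not_gt hb
      refine ⟨insert a C, ?_, ?_, ?_, by rw [Finset.card_insert_of_notMem haC, hcard]⟩
      · rw [Finset.coe_insert]
        exact hC.insert fun c hc _ => Or.inr ((hle c hc).trans hb.le)
      · simp only [Finset.mem_insert, not_or]
        exact ⟨fun h' => by simp [← h', natHeight_bot] at h, hbot⟩
      · intro c hc
        rcases Finset.mem_insert.1 hc with rfl | hc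
        · exact le_rfl
        · exact (hle c hc).trans hb.le
  exact key _ a rfl

end Height

/-! ### Length as a height in the subsemigroup lattice -/

section Length

variable {S : Type*} [Semigroup S] [Finite S]

instance finite_subsemigroup : Finite (Subsemigroup S) :=
  Finite.of_injective (fun T : Subsemigroup S => (T : Set S)) SetLike.coe_injective

theorem coe_nonempty_iff_ne_bot {S : Type*} [Semigroup S] (T : Subsemigroup S) :
    (T : Set S).Nonempty ↔ T ≠ ⊥ := by
  rw [Set.nonempty_iff_ne_empty, ← Subsemigroup.coe_bot, Ne, SetLike.coe_set_eq]

theorem sSup_chainSizes_eq : sSup (chainSizes S) = natHeight (⊤ : Subsemigroup S) := by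
  obtain ⟨⟨C, hne, hC, hcard⟩, hub⟩ := isGreatest_chainSizes S
  apply le_antisymm
  · rw [← hcard]
    exact card_le_natHeight hC (fun h => (coe_nonempty_iff_ne_bot _).1 (hne _ h) rfl)
      fun _ _ => le_top
  · obtain ⟨D, hD, hbot, -, hDcard⟩ := exists_chain_card_eq_natHeight (⊤ : Subsemigroup S)
    exact hub ⟨D, fun T hT => (coe_nonempty_iff_ne_bot T).2 fun h => hbot (h ▸ hT), hD, hDcard⟩

theorem length_eq_natHeight_top : length S = (natHeight (⊤ : Subsemigroup S) : ℤ) - 1 := by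
  rw [length, sSup_chainSizes_eq]

theorem natHeight_top_coe (G : Subsemigroup S) :
    natHeight (⊤ : Subsemigroup G) = natHeight G := by
  apply le_antisymm
  · have h := natHeight_le_natHeight_apply (f := Subsemigroup.map (MulMemClass.subtype G))
      (a := (⊤ : Subsemigroup G))
      ((Monotone.strictMono_of_injective (Subsemigroup.gc_map_comap _).monotone_l
        (Subsemigroup.map_injective_of_injective (f := MulMemClass.subtype G)
          Subtype.coe_injective)).strictMonoOn _)
    refine h.trans (natHeight_strictMono.monotone ?_)
    rintro _ ⟨x, -, rfl⟩
    exact x.2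
  · refine (natHeight_le_natHeight_apply
      (f := Subsemigroup.comap (MulMemClass.subtype G)) (a := G) ?_).trans
      (natHeight_strictMono.monotone le_top)
    intro T hT U hU h
    refine lt_of_le_not_ge (fun x hx => h.le hx) fun hle => h.not_ge ?_
    intro x hx
    exact @hle ⟨x, hU hx⟩ hx

theorem length_coe_eq_natHeight (G : Subsemigroup S) : length G = (natHeight G : ℤ) - 1 := by
  rw [length_eq_natHeight_top, natHeight_top_coe]

end Length

end FiniteSemigroup

namespace FiniteSemigroup

/-! ### Green's relations in completely regular semigroups -/

section Ideals

variable {S : Type*} [Semigroup S]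

theorem mem_leftIdeal_self (x : S) : x ∈ leftIdeal x := Or.inl rfl

theorem mem_rightIdeal_self (x : S) : x ∈ rightIdeal x := Or.inl rfl

theorem mem_twoSidedIdeal_self (x : S) : x ∈ twoSidedIdeal x := Or.inl rfl

theorem leftIdeal_subset_iff {x y : S} : leftIdeal x ⊆ leftIdeal y ↔ x ∈ leftIdeal y := by
  refine ⟨fun h => h (mem_leftIdeal_self x), ?_⟩
  rintro (rfl | ⟨s, rfl⟩)
  · exact subset_rfl
  · rintro z (rfl | ⟨t, rfl⟩)
    · exact Or.inr ⟨s, rfl⟩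
    · exact Or.inr ⟨t * s, (mul_assoc _ _ _).symm⟩

theorem rightIdeal_subset_iff {x y : S} : rightIdeal x ⊆ rightIdeal y ↔ x ∈ rightIdeal y := by
  refine ⟨fun h => h (mem_rightIdeal_self x), ?_⟩
  rintro (rfl | ⟨s, rfl⟩)
  · exact subset_rfl
  · rintro z (rfl | ⟨t, rfl⟩)
    · exact Or.inr ⟨s, rfl⟩
    · exact Or.inr ⟨s * t, mul_assoc _ _ _⟩

theorem mul_left_mem_twoSidedIdeal {x z : S} (h : z ∈ twoSidedIdeal x) (s : S) :
    s * z ∈ twoSidedIdeal x := by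
  rcases h with rfl | ⟨u, rfl⟩ | ⟨u, rfl⟩ | ⟨u, v, rfl⟩
  · exact Or.inr (Or.inl ⟨s, rfl⟩)
  · exact Or.inr (Or.inl ⟨s * u, (mul_assoc _ _ _).symm⟩)
  · exact Or.inr (Or.inr (Or.inr ⟨s, u, (mul_assoc _ _ _).symm⟩))
  · exact Or.inr (Or.inr (Or.inr ⟨s * u, v, by simp only [mul_assoc]⟩))

theorem mul_right_mem_twoSidedIdeal {x z : S} (h : z ∈ twoSidedIdeal x) (s : S) :
    z * s ∈ twoSidedIdeal x := by
  rcases h with rfl | ⟨u, rfl⟩ | ⟨u, rfl⟩ | ⟨u, v, rfl⟩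
  · exact Or.inr (Or.inr (Or.inl ⟨s, rfl⟩))
  · exact Or.inr (Or.inr (Or.inr ⟨u, s, rfl⟩))
  · exact Or.inr (Or.inr (Or.inl ⟨u * s, mul_assoc _ _ _⟩))
  · exact Or.inr (Or.inr (Or.inr ⟨u, v * s, by simp only [mul_assoc]⟩))

theorem twoSidedIdeal_subset_iff {x y : S} :
    twoSidedIdeal x ⊆ twoSidedIdeal y ↔ x ∈ twoSidedIdeal y := by
  refine ⟨fun h => h (mem_twoSidedIdeal_self x), fun h => ?_⟩
  rintro z (rfl | ⟨s, rfl⟩ | ⟨s, rfl⟩ | ⟨s, t, rfl⟩)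
  · exact h
  · exact mul_left_mem_twoSidedIdeal h s
  · exact mul_right_mem_twoSidedIdeal h s
  · exact mul_right_mem_twoSidedIdeal (mul_left_mem_twoSidedIdeal h s) t

theorem leftIdeal_mul_subset (s x : S) : leftIdeal (s * x) ⊆ leftIdeal x :=
  leftIdeal_subset_iff.2 (Or.inr ⟨s, rfl⟩)

theorem rightIdeal_mul_subset (x s : S) : rightIdeal (x * s) ⊆ rightIdeal x :=
  rightIdeal_subset_iff.2 (Or.inr ⟨s, rfl⟩)

theorem twoSidedIdeal_mul_subset_left (x s : S) : twoSidedIdeal (x * s) ⊆ twoSidedIdeal x :=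
  twoSidedIdeal_subset_iff.2 (mul_right_mem_twoSidedIdeal (mem_twoSidedIdeal_self x) s)

theorem twoSidedIdeal_mul_subset_right (s x : S) : twoSidedIdeal (s * x) ⊆ twoSidedIdeal x :=
  twoSidedIdeal_subset_iff.2 (mul_left_mem_twoSidedIdeal (mem_twoSidedIdeal_self x) s)

theorem twoSidedIdeal_subset_of_leftIdeal_subset {x y : S} (h : leftIdeal x ⊆ leftIdeal y) :
    twoSidedIdeal x ⊆ twoSidedIdeal y := by
  rcases leftIdeal_subset_iff.1 h with rfl | ⟨s, rfl⟩
  · exact subset_rfl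
  · exact twoSidedIdeal_mul_subset_right _ _

theorem twoSidedIdeal_eq_of_leftIdeal_eq {x y : S} (h : leftIdeal x = leftIdeal y) :
    twoSidedIdeal x = twoSidedIdeal y :=
  (twoSidedIdeal_subset_of_leftIdeal_subset h.subset).antisymm
    (twoSidedIdeal_subset_of_leftIdeal_subset h.superset)

theorem twoSidedIdeal_subset_of_rightIdeal_subset {x y : S} (h : rightIdeal x ⊆ rightIdeal y) :
    twoSidedIdeal x ⊆ twoSidedIdeal y := by
  rcases rightIdeal_subset_iff.1 h with rfl | ⟨s, rfl⟩
  · exact subset_rfl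
  · exact twoSidedIdeal_mul_subset_left _ _

theorem twoSidedIdeal_eq_of_rightIdeal_eq {x y : S} (h : rightIdeal x = rightIdeal y) :
    twoSidedIdeal x = twoSidedIdeal y :=
  (twoSidedIdeal_subset_of_rightIdeal_subset h.subset).antisymm
    (twoSidedIdeal_subset_of_rightIdeal_subset h.superset)

theorem mul_eq_self_of_leftIdeal_subset {x e : S} (he : e * e = e)
    (h : leftIdeal x ⊆ leftIdeal e) : x * e = x := by
  rcases leftIdeal_subset_iff.1 h with rfl | ⟨s, rfl⟩
  · exact he
  · rw [mul_assoc, he]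

theorem mul_eq_self_of_rightIdeal_subset {x e : S} (he : e * e = e)
    (h : rightIdeal x ⊆ rightIdeal e) : e * x = x := by
  rcases rightIdeal_subset_iff.1 h with rfl | ⟨s, rfl⟩
  · exact he
  · rw [← mul_assoc, he]

theorem IsCompletelyRegular.exists_inverse (hS : IsCompletelyRegular S) (x : S) :
    ∃ y, x * y * x = x ∧ y * x * y = y ∧ x * y = y * x := by
  obtain ⟨G, ⟨e, -, he, hinv⟩, hx⟩ := hS x
  obtain ⟨y, hy, h1, h2⟩ := hinv x hx
  exact ⟨y, by rw [h1, (he x hx).1], by rw [h2, (he y hy).1], h1.trans h2.symm⟩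

theorem IsCompletelyRegular.exists_idempotent (hS : IsCompletelyRegular S) (x : S) :
    ∃ e, e * e = e ∧ leftIdeal e = leftIdeal x ∧ rightIdeal e = rightIdeal x := by
  obtain ⟨y, h1, h2, h3⟩ := hS.exists_inverse x
  refine ⟨x * y, by rw [← mul_assoc, h1], ?_, ?_⟩
  · refine Set.Subset.antisymm (h3 ▸ leftIdeal_mul_subset y x) ?_
    exact leftIdeal_subset_iff.2 (Or.inr ⟨x, by rw [h3, ← mul_assoc, h1]⟩)
  · refine Set.Subset.antisymm (rightIdeal_mul_subset x y) ?_
    exact rightIdeal_subset_iff.2 (Or.inr ⟨x, h1.symm⟩)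

/-- Left multiplication by `x` is injective on the elements of `T` fixed by `y * x`, hence
surjective by finiteness. Solving `x * t = x` puts `x * y` in `T`; then solving `x * u = x * y` puts
`y` there. -/
theorem mem_subsemigroup_of_inverse [Finite S] {T : Subsemigroup S} {x y : S} (hx : x ∈ T)
    (h1 : x * y * x = x) (h2 : y * x * y = y) (h3 : x * y = y * x) : y ∈ T := by
  let K : Set S := {t | t ∈ T ∧ y * x * t = t}
  let f : K → K := fun t => ⟨x * t, T.mul_mem hx t.2.1, by
    rw [← mul_assoc, ← h3, h1]⟩
  have hf : Function.Injective f := by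
    rintro ⟨s, hs⟩ ⟨t, ht⟩ h
    have h' : x * s = x * t := congrArg Subtype.val h
    refine Subtype.ext ?_
    show s = t
    rw [← hs.2, ← ht.2, mul_assoc, h', mul_assoc]
  have hsurj := Finite.surjective_of_injective hf
  obtain ⟨⟨t, ht⟩, h⟩ := hsurj ⟨x, hx, by rw [← h3, h1]⟩
  have h' : x * t = x := congrArg Subtype.val h
  have hxy : x * y ∈ T := by
    have : t = x * y := by rw [← ht.2, mul_assoc, h', h3]
    exact this ▸ ht.1
  obtain ⟨⟨u, hu⟩, h⟩ := hsurj ⟨x * y, hxy, by rw [← mul_assoc, ← h3, h1]⟩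
  have h' : x * u = x * y := congrArg Subtype.val h
  have : u = y := by rw [← hu.2, mul_assoc, h', ← mul_assoc, h2]
  exact this ▸ hu.1

theorem exists_mul_mul_eq_of_mem_twoSidedIdeal (hS : IsCompletelyRegular S) {x z : S}
    (h : z ∈ twoSidedIdeal x) : ∃ s t, z = s * x * t := by
  obtain ⟨y, h1, -, -⟩ := hS.exists_inverse x
  rcases h with rfl | ⟨s, rfl⟩ | ⟨s, rfl⟩ | ⟨s, t, rfl⟩
  · exact ⟨z * y, y * z, by simp only [← mul_assoc, h1]⟩
  · exact ⟨s, y * x, by simp only [mul_assoc] at h1 ⊢; rw [h1]⟩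
  · exact ⟨x * y, s, by rw [h1]⟩
  · exact ⟨s, t, rfl⟩

theorem twoSidedIdeal_mul_comm_subset (hS : IsCompletelyRegular S) (x y : S) :
    twoSidedIdeal (x * y) ⊆ twoSidedIdeal (y * x) := by
  obtain ⟨w, h1, -, h3⟩ := hS.exists_inverse (x * y)
  have h : x * y = x * (y * x) * (y * w) := by
    conv_lhs => rw [← h1, mul_assoc, ← h3]
    simp only [mul_assoc]
  rw [h]
  exact (twoSidedIdeal_mul_subset_left _ _).trans (twoSidedIdeal_mul_subset_right _ _)

/-- The element z lies in the ideal of z², and z² written through both factorizations contains `y *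
(v * s) * x`, which rotates cyclically to a multiple of `x * y`. -/
theorem mem_twoSidedIdeal_mul (hS : IsCompletelyRegular S) {x y z : S}
    (hx : z ∈ twoSidedIdeal x) (hy : z ∈ twoSidedIdeal y) : z ∈ twoSidedIdeal (x * y) := by
  obtain ⟨s, t, hst⟩ := exists_mul_mul_eq_of_mem_twoSidedIdeal hS hx
  obtain ⟨u, v, huv⟩ := exists_mul_mul_eq_of_mem_twoSidedIdeal hS hy
  obtain ⟨w, h1, -, h3⟩ := hS.exists_inverse z
  have h : z = u * (y * (v * s) * x) * (t * w) := by
    calc z = z * z * w := by rw [mul_assoc, h3, ← mul_assoc, h1]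
      _ = (u * y * v) * (s * x * t) * w := by rw [← hst, ← huv]
      _ = _ := by simp only [mul_assoc]
  rw [← twoSidedIdeal_subset_iff, h]
  refine ((twoSidedIdeal_mul_subset_left _ _).trans (twoSidedIdeal_mul_subset_right _ _)).trans ?_
  refine (twoSidedIdeal_mul_comm_subset hS _ _).trans ?_
  rw [← mul_assoc]
  exact twoSidedIdeal_mul_subset_left _ _

/-- Stability without finiteness: with g = `y * t`, `x = s * x * g` is fixed on the right by the
idempotent `g * w`, where w is the commuting inverse of g. Hence `x` is a right multiple of `x * y`.
-/
theorem rightIdeal_mul_eq (hS : IsCompletelyRegular S) {x y : S}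
    (h : twoSidedIdeal x ⊆ twoSidedIdeal (x * y)) : rightIdeal (x * y) = rightIdeal x := by
  refine (rightIdeal_mul_subset x y).antisymm ?_
  obtain ⟨s, t, hst⟩ := exists_mul_mul_eq_of_mem_twoSidedIdeal hS (twoSidedIdeal_subset_iff.1 h)
  obtain ⟨w, h1, -, h3⟩ := hS.exists_inverse (y * t)
  have h2 : x = s * (x * (y * t)) := by simpa only [mul_assoc] using hst
  refine rightIdeal_subset_iff.2 (Or.inr ⟨t * w, ?_⟩)
  calc x = s * (x * (y * t)) := h2
    _ = s * (x * (y * t * (y * t * w))) := by rw [h3, ← mul_assoc (y * t) w, h1]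
    _ = s * (x * (y * t)) * (y * t * w) := by simp only [mul_assoc]
    _ = x * y * (t * w) := by rw [← h2]; simp only [mul_assoc]

theorem leftIdeal_mul_eq (hS : IsCompletelyRegular S) {x y : S}
    (h : twoSidedIdeal y ⊆ twoSidedIdeal (x * y)) : leftIdeal (x * y) = leftIdeal y := by
  refine (leftIdeal_mul_subset x y).antisymm ?_
  obtain ⟨s, t, hst⟩ := exists_mul_mul_eq_of_mem_twoSidedIdeal hS (twoSidedIdeal_subset_iff.1 h)
  obtain ⟨w, h1, -, h3⟩ := hS.exists_inverse (s * x)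
  have h2 : y = s * x * y * t := by simpa only [mul_assoc] using hst
  refine leftIdeal_subset_iff.2 (Or.inr ⟨w * s, ?_⟩)
  calc y = s * x * y * t := h2
    _ = (s * x * w * (s * x)) * y * t := by rw [h1]
    _ = w * (s * x) * (s * x * y * t) := by rw [h3]; simp only [mul_assoc]
    _ = w * s * (x * y) := by rw [← h2]; simp only [mul_assoc]

theorem green_mul (hS : IsCompletelyRegular S) {x y : S} (h : twoSidedIdeal x = twoSidedIdeal y) :
    twoSidedIdeal (x * y) = twoSidedIdeal y ∧ leftIdeal (x * y) = leftIdeal y ∧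
      rightIdeal (x * y) = rightIdeal x := by
  have h1 : twoSidedIdeal y ⊆ twoSidedIdeal (x * y) :=
    twoSidedIdeal_subset_iff.2
      (mem_twoSidedIdeal_mul hS (h ▸ mem_twoSidedIdeal_self y) (mem_twoSidedIdeal_self y))
  exact ⟨(twoSidedIdeal_mul_subset_right _ _).antisymm h1, leftIdeal_mul_eq hS h1,
    rightIdeal_mul_eq hS (h ▸ h1)⟩

end Ideals

/-! ### Rectangles, H-classes and maximal subgroups -/

section Rectangles

variable {S : Type*} [Semigroup S]

/-- The elements of the `J`-class of the elements generating the ideal `j` whose principal left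
ideal is in `A` and whose principal right ideal is in `B`. -/
def rectangle (hS : IsCompletelyRegular S) (j : Set S) (A B : Set (Set S)) : Subsemigroup S where
  carrier := {x | twoSidedIdeal x = j ∧ leftIdeal x ∈ A ∧ rightIdeal x ∈ B}
  mul_mem' := by
    rintro x y ⟨hx, hxA, hxB⟩ ⟨hy, hyA, hyB⟩
    obtain ⟨h1, h2, h3⟩ := green_mul hS (hx.trans hy.symm)
    exact ⟨h1.trans hy, by rwa [h2], by rwa [h3]⟩

theorem mem_rectangle {hS : IsCompletelyRegular S} {j : Set S} {A B : Set (Set S)} {x : S} :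
    x ∈ rectangle hS j A B ↔ twoSidedIdeal x = j ∧ leftIdeal x ∈ A ∧ rightIdeal x ∈ B :=
  Iff.rfl

/-- The `H`-class of `x`. -/
def hClass (hS : IsCompletelyRegular S) (x : S) : Subsemigroup S :=
  rectangle hS (twoSidedIdeal x) {leftIdeal x} {rightIdeal x}

theorem mem_hClass {hS : IsCompletelyRegular S} {x y : S} :
    y ∈ hClass hS x ↔ leftIdeal y = leftIdeal x ∧ rightIdeal y = rightIdeal x :=
  ⟨fun h => h.2, fun h => ⟨twoSidedIdeal_eq_of_leftIdeal_eq h.1, h⟩⟩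

theorem mem_hClass_self (hS : IsCompletelyRegular S) (x : S) : x ∈ hClass hS x :=
  mem_hClass.2 ⟨rfl, rfl⟩

theorem hClass_eq_of_mem {hS : IsCompletelyRegular S} {x y : S} (h : y ∈ hClass hS x) :
    hClass hS y = hClass hS x := by
  obtain ⟨h1, h2⟩ := mem_hClass.1 h
  rw [hClass, hClass, h1, h2, twoSidedIdeal_eq_of_leftIdeal_eq h1]

theorem eq_of_idempotent_of_mem_hClass {hS : IsCompletelyRegular S} {e f : S} (he : e * e = e)
    (hf : f * f = f) (h : f ∈ hClass hS e) : f = e := by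
  obtain ⟨h1, h2⟩ := mem_hClass.1 h
  rw [← mul_eq_self_of_leftIdeal_subset he h1.subset,
    mul_eq_self_of_rightIdeal_subset hf h2.superset]

theorem inverse_mem_hClass {hS : IsCompletelyRegular S} {x y : S} (h1 : x * y * x = x)
    (h2 : y * x * y = y) (h3 : x * y = y * x) : y ∈ hClass hS x := by
  have hx : x = x * x * y := by rw [mul_assoc, h3, ← mul_assoc, h1]
  have hx' : x = y * x * x := by rw [← h3, h1]
  have hy : y = y * y * x := by rw [mul_assoc, ← h3, ← mul_assoc, h2]
  have hy' : y = x * y * y := by rw [h3, h2]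
  refine mem_hClass.2 ⟨Set.Subset.antisymm ?_ ?_, Set.Subset.antisymm ?_ ?_⟩
  · exact leftIdeal_subset_iff.2 (Or.inr ⟨_, hy⟩)
  · exact leftIdeal_subset_iff.2 (Or.inr ⟨_, hx⟩)
  · exact rightIdeal_subset_iff.2 (Or.inr ⟨y * y, by rw [← mul_assoc, ← hy']⟩)
  · exact rightIdeal_subset_iff.2 (Or.inr ⟨x * x, by rw [← mul_assoc, ← hx']⟩)

theorem exists_inverse_of_mem_hClass {hS : IsCompletelyRegular S} {x e : S} (he : e * e = e)
    (hx : x ∈ hClass hS e) : ∃ y ∈ hClass hS e, x * y = e ∧ y * x = e := by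
  obtain ⟨y, h1, h2, h3⟩ := hS.exists_inverse x
  have hy : y ∈ hClass hS e := hClass_eq_of_mem hx ▸ inverse_mem_hClass h1 h2 h3
  have h4 : x * y = e := eq_of_idempotent_of_mem_hClass he (by rw [← mul_assoc, h1])
    (mul_mem hx hy)
  exact ⟨y, hy, h4, h3 ▸ h4⟩

theorem hClass_mul {hS : IsCompletelyRegular S} {x e : S} (he : e * e = e)
    (hx : x ∈ hClass hS e) : e * x = x ∧ x * e = x :=
  ⟨mul_eq_self_of_rightIdeal_subset he (mem_hClass.1 hx).2.subset,
    mul_eq_self_of_leftIdeal_subset he (mem_hClass.1 hx).1.subset⟩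

theorem isSubgroup_hClass (hS : IsCompletelyRegular S) {e : S} (he : e * e = e) :
    IsSubgroup (hClass hS e) :=
  ⟨e, mem_hClass_self hS e, fun _ hx => hClass_mul he hx,
    fun _ hx => exists_inverse_of_mem_hClass he hx⟩

theorem IsMaximalSubgroup.eq_hClass (hS : IsCompletelyRegular S) {G : Subsemigroup S}
    (hG : IsMaximalSubgroup G) : ∃ e ∈ G, G = hClass hS e := by
  obtain ⟨e, he, h1, hinv⟩ := hG.1
  have hee : e * e = e := (h1 e he).1
  have hle : G ≤ hClass hS e := by
    intro x hx
    obtain ⟨y, -, hxy, hyx⟩ := hinv x hx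
    refine mem_hClass.2 ⟨Set.Subset.antisymm ?_ ?_, Set.Subset.antisymm ?_ ?_⟩
    · exact leftIdeal_subset_iff.2 (Or.inr ⟨x, (h1 x hx).2.symm⟩)
    · exact leftIdeal_subset_iff.2 (Or.inr ⟨y, hyx.symm⟩)
    · exact rightIdeal_subset_iff.2 (Or.inr ⟨x, (h1 x hx).1.symm⟩)
    · exact rightIdeal_subset_iff.2 (Or.inr ⟨y, hxy.symm⟩)
  exact ⟨e, he, hle.antisymm (hG.2 (isSubgroup_hClass hS hee) hle)⟩

theorem mul_mul_mem_hClass {hS : IsCompletelyRegular S} {f z u v : S}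
    (hz : z = f * u) (hz' : z = v * f) (h : f ∈ twoSidedIdeal z) : z ∈ hClass hS f := by
  have h := twoSidedIdeal_subset_iff.2 h
  refine mem_hClass.2 ⟨?_, ?_⟩
  · rw [hz'] at h ⊢; exact leftIdeal_mul_eq hS h
  · rw [hz] at h ⊢; exact rightIdeal_mul_eq hS h

/-- Take `a = e * f` and `b = f * c`, where `c` inverts `e * f * e` in the H-class of `e`. Then `b *
a` is an idempotent in the H-class of `f`, so it is `f`. -/
theorem exists_mul_eq_of_twoSidedIdeal_eq (hS : IsCompletelyRegular S) {e f : S} (he : e * e = e)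
    (hf : f * f = f) (h : twoSidedIdeal e = twoSidedIdeal f) :
    ∃ a b, a * b = e ∧ b * a = f ∧ e * a = a ∧ a * f = a ∧ f * b = b ∧ b * e = b := by
  have hu : e * f * e ∈ hClass hS e := by
    refine mul_mul_mem_hClass (u := f * e) (v := e * f) (mul_assoc _ _ _) rfl ?_
    have hef : twoSidedIdeal (e * f) = twoSidedIdeal e := ((green_mul hS h).1).trans h.symm
    rw [(green_mul hS hef).1]
    exact mem_twoSidedIdeal_self e
  obtain ⟨c, hc, h1, -⟩ := exists_inverse_of_mem_hClass he hu
  obtain ⟨hec, hce⟩ := hClass_mul he hc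
  have hab : e * f * (f * c) = e := by
    calc e * f * (f * c) = e * (f * f) * c := by simp only [mul_assoc]
      _ = e := by rw [hf, ← hec, ← mul_assoc (e * f), h1]
  have hba : f * c * (e * f) = f * c * f := by rw [← mul_assoc, mul_assoc f c e, hce]
  have hidem : f * c * (e * f) * (f * c * (e * f)) = f * c * (e * f) := by
    calc f * c * (e * f) * (f * c * (e * f)) = f * c * (e * f * (f * c)) * (e * f) := by
          simp only [mul_assoc]
      _ = _ := by rw [hab, mul_assoc f c e, hce]
  refine ⟨e * f, f * c, hab, ?_, by rw [← mul_assoc, he], by rw [mul_assoc, hf],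
    by rw [← mul_assoc, hf], by rw [mul_assoc, hce]⟩
  refine eq_of_idempotent_of_mem_hClass (hS := hS) hf hidem ?_
  refine mul_mul_mem_hClass (mul_assoc f c (e * f)) (v := f * c * e) (by rw [mul_assoc (f * c)]) ?_
  refine (?_ : twoSidedIdeal e ⊆ _) (h ▸ mem_twoSidedIdeal_self f)
  have : e = e * f * (f * c * (e * f)) * (f * c) := by
    rw [← mul_assoc (e * f) (f * c), hab, mul_assoc e, hab, he]
  conv_lhs => rw [this]
  exact (twoSidedIdeal_mul_subset_left _ _).trans (twoSidedIdeal_mul_subset_right _ _)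

/-- On the H-class of `f` the map z ↦ `a * z * b` is multiplicative because `b * a = f`, and it
reaches every x in the H-class of `e` from `b * x * a`; preimages of subsemigroups therefore stay
strictly ordered. -/
theorem natHeight_hClass_le_of_idempotent [Finite S] (hS : IsCompletelyRegular S) {e f : S}
    (he : e * e = e) (hf : f * f = f) (h : twoSidedIdeal e = twoSidedIdeal f) :
    natHeight (hClass hS e) ≤ natHeight (hClass hS f) := by
  obtain ⟨a, b, hab, hba, hea, haf, hfb, hbe⟩ := exists_mul_eq_of_twoSidedIdeal_eq hS he hf h
  let φ : Subsemigroup S → Subsemigroup S := fun T =>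
    { carrier := {z | z ∈ hClass hS f ∧ a * z * b ∈ T}
      mul_mem' := by
        rintro z w ⟨hz, hzT⟩ ⟨hw, hwT⟩
        refine ⟨mul_mem hz hw, ?_⟩
        have : a * (z * w) * b = a * z * b * (a * w * b) := by
          calc a * (z * w) * b = a * (z * (f * w)) * b := by rw [(hClass_mul hf hw).1]
            _ = a * (z * (b * a * w)) * b := by rw [hba]
            _ = _ := by simp only [mul_assoc]
        rw [this]
        exact mul_mem hzT hwT }
  have hφ : StrictMonoOn φ (Set.Iic (hClass hS e)) := by
    intro T _ T' hT' hlt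
    refine lt_of_le_not_ge (fun z hz => ⟨hz.1, hlt.le hz.2⟩) fun hle => hlt.not_ge fun x hx => ?_
    obtain ⟨hex, hxe⟩ := hClass_mul he (hT' hx)
    have hz : a * (b * x * a) * b = x := by
      calc a * (b * x * a) * b = (a * b) * x * (a * b) := by simp only [mul_assoc]
        _ = x := by rw [hab, hex, hxe]
    have hmem : b * x * a ∈ hClass hS f := by
      refine mul_mul_mem_hClass (u := b * x * a) (v := b * x * a)
        (by simp only [← mul_assoc]; rw [hfb]) (by simp only [mul_assoc]; rw [haf]) ?_
      have hxf : f ∈ twoSidedIdeal x := by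
        rw [twoSidedIdeal_eq_of_leftIdeal_eq (mem_hClass.1 (hT' hx)).1, h]
        exact mem_twoSidedIdeal_self f
      refine (?_ : twoSidedIdeal x ⊆ _) hxf
      conv_lhs => rw [← hz]
      exact (twoSidedIdeal_mul_subset_left _ _).trans (twoSidedIdeal_mul_subset_right _ _)
    have := (@hle (b * x * a) ⟨hmem, by rw [hz]; exact hx⟩).2
    rwa [hz] at this
  exact (natHeight_le_natHeight_apply hφ).trans
    (natHeight_strictMono.monotone fun z hz => hz.1)

theorem natHeight_hClass_eq [Finite S] (hS : IsCompletelyRegular S) {x y : S}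
    (h : twoSidedIdeal x = twoSidedIdeal y) :
    natHeight (hClass hS x) = natHeight (hClass hS y) := by
  obtain ⟨e, he, hex⟩ := hS.exists_idempotent x
  obtain ⟨f, hf, hfy⟩ := hS.exists_idempotent y
  rw [← hClass_eq_of_mem (hS := hS) (mem_hClass.2 hex),
    ← hClass_eq_of_mem (hS := hS) (mem_hClass.2 hfy)]
  have h' : twoSidedIdeal e = twoSidedIdeal f := by
    rw [twoSidedIdeal_eq_of_leftIdeal_eq hex.1, h, twoSidedIdeal_eq_of_leftIdeal_eq hfy.1]
  exact (natHeight_hClass_le_of_idempotent hS he hf h').antisymm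
    (natHeight_hClass_le_of_idempotent hS hf he h'.symm)

end Rectangles

end FiniteSemigroup

namespace FiniteSemigroup

/-! ### Upper bound: a strictly increasing rank -/

section Rank

variable {S : Type*} [Semigroup S] [Finite S]

theorem exists_idempotent_mem (hS : IsCompletelyRegular S) {T : Subsemigroup S} {x : S}
    (hx : x ∈ T) : ∃ e ∈ T, e * e = e ∧ e ∈ hClass hS x := by
  obtain ⟨y, h1, h2, h3⟩ := hS.exists_inverse x
  exact ⟨x * y, mul_mem hx (mem_subsemigroup_of_inverse hx h1 h2 h3), by rw [← mul_assoc, h1],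
    mul_mem (mem_hClass_self hS x) (inverse_mem_hClass h1 h2 h3)⟩

/-- The inverse of `a * e * a` in the H-class of `a` lies in `T`, so passing from `a` to `e * a` or
`a * e` can be undone within `T`. -/
theorem exists_mul_mul_eq_of_mem (hS : IsCompletelyRegular S) {T : Subsemigroup S} {a e : S}
    (ha : a ∈ T) (he : e ∈ T) (haa : a * a = a) (h : twoSidedIdeal a = twoSidedIdeal e) :
    (∃ p ∈ T, p * (e * a) = a) ∧ ∃ q ∈ T, a * e * q = a := by
  have hu : a * e * a ∈ hClass hS a := by
    refine mul_mul_mem_hClass (u := e * a) (v := a * e) (mul_assoc _ _ _) rfl ?_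
    have hae : twoSidedIdeal (a * e) = twoSidedIdeal a := ((green_mul hS h).1).trans h.symm
    rw [(green_mul hS hae).1]
    exact mem_twoSidedIdeal_self a
  obtain ⟨v, hv, huv, hvu⟩ := exists_inverse_of_mem_hClass haa hu
  have hvT : v ∈ T := mem_subsemigroup_of_inverse (mul_mem (mul_mem ha he) ha)
    (by rw [huv, (hClass_mul haa hu).1]) (by rw [hvu, (hClass_mul haa hv).1])
    (huv.trans hvu.symm)
  exact ⟨⟨v * a, mul_mem hvT ha, by simpa only [mul_assoc] using hvu⟩,
    ⟨a * v, mul_mem ha hvT, by simpa only [mul_assoc] using huv⟩⟩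

/-- With `e` the idempotent of `T` in the H-class of `y`, the element `e * x * e` lies there, and `x
= p * (e * x * e) * q` with `p`, `q` in `T`. So `e * x * e` is in `T'` but not in `T`. -/
theorem inf_hClass_lt (hS : IsCompletelyRegular S) {T T' : Subsemigroup S} (hle : T ≤ T')
    {x a b w y : S} (hx : x ∈ T') (hxT : x ∉ T) (ha : a ∈ T) (hax : rightIdeal a = rightIdeal x)
    (hb : b ∈ T) (hbx : leftIdeal b = leftIdeal x) (hw : w ∈ T) (hwy : w ∈ hClass hS y)
    (hyx : twoSidedIdeal y = twoSidedIdeal x) : T ⊓ hClass hS y < T' ⊓ hClass hS y := by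
  obtain ⟨e, heT, hee, hew⟩ := exists_idempotent_mem hS hw
  obtain ⟨a', haT, haa, ha'⟩ := exists_idempotent_mem hS ha
  obtain ⟨b', hbT, hbb, hb'⟩ := exists_idempotent_mem hS hb
  have hey : e ∈ hClass hS y := hClass_eq_of_mem hwy ▸ hew
  have hex : twoSidedIdeal e = twoSidedIdeal x :=
    (twoSidedIdeal_eq_of_leftIdeal_eq (mem_hClass.1 hey).1).trans hyx
  have hRa : rightIdeal a' = rightIdeal x := (mem_hClass.1 ha').2.trans hax
  have hLb : leftIdeal b' = leftIdeal x := (mem_hClass.1 hb').1.trans hbx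
  obtain ⟨p, hp, hpa⟩ := (exists_mul_mul_eq_of_mem hS haT heT haa
    ((twoSidedIdeal_eq_of_rightIdeal_eq hRa).trans hex.symm)).1
  obtain ⟨q, hq, hqb⟩ := (exists_mul_mul_eq_of_mem hS hbT heT hbb
    ((twoSidedIdeal_eq_of_leftIdeal_eq hLb).trans hex.symm)).2
  have hax' : a' * x = x := mul_eq_self_of_rightIdeal_subset haa hRa.superset
  have hxb' : x * b' = x := mul_eq_self_of_leftIdeal_subset hbb hLb.superset
  refine lt_of_le_not_ge (inf_le_inf_right _ hle) fun hge => hxT ?_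
  have hmem : e * x * e ∈ hClass hS y := by
    rw [← hClass_eq_of_mem hey]
    refine mul_mul_mem_hClass (u := x * e) (v := e * x) (mul_assoc _ _ _) rfl ?_
    have h1 := (green_mul hS hex).1
    rw [(green_mul hS (h1.trans hex.symm)).1]
    exact mem_twoSidedIdeal_self e
  have hT : e * x * e ∈ T :=
    (hge ⟨mul_mem (mul_mem (hle heT) hx) (hle heT), hmem⟩).1
  have hfac : x = p * (e * x * e) * q := by
    calc x = a' * x * b' := by rw [hax', hxb']
      _ = p * (e * a') * x * (b' * e * q) := by rw [hpa, hqb]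
      _ = p * (e * (a' * x * b') * e) * q := by simp only [mul_assoc]
      _ = _ := by rw [hax', hxb']
  rw [hfac]
  exact mul_mem (mul_mem hp hT) hq

/-- The largest height of the intersection of `T` with an `H`-class contained in the `J`-class of
the generators of `j`. -/
noncomputable def maxHeight (hS : IsCompletelyRegular S) (j : Set S) (T : Subsemigroup S) : ℕ :=
  (Set.toFinite {x : S | twoSidedIdeal x = j}).toFinset.sup fun x => natHeight (T ⊓ hClass hS x)

theorem natHeight_inf_le_maxHeight (hS : IsCompletelyRegular S) {j : Set S} (T : Subsemigroup S)
    {x : S} (hx : twoSidedIdeal x = j) : natHeight (T ⊓ hClass hS x) ≤ maxHeight hS j T :=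
  Finset.le_sup (f := fun x => natHeight (T ⊓ hClass hS x)) (by simpa using hx)

theorem exists_maxHeight_eq (hS : IsCompletelyRegular S) {j : Set S} (T : Subsemigroup S)
    {x : S} (hx : twoSidedIdeal x = j) :
    ∃ y, twoSidedIdeal y = j ∧ maxHeight hS j T = natHeight (T ⊓ hClass hS y) := by
  obtain ⟨y, hy, h⟩ := Finset.exists_mem_eq_sup
    (Set.toFinite {x : S | twoSidedIdeal x = j}).toFinset ⟨x, by simpa using hx⟩
    fun x => natHeight (T ⊓ hClass hS x)
  exact ⟨y, by simpa using hy, h⟩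

theorem maxHeight_mono (hS : IsCompletelyRegular S) (j : Set S) : Monotone (maxHeight hS j) :=
  fun _ _ h => Finset.sup_mono_fun fun _ _ => natHeight_strictMono.monotone (inf_le_inf_right _ h)

theorem natHeight_pos {T : Subsemigroup S} {x : S} (hx : x ∈ T) : 0 < natHeight T := by
  have h : (⊥ : Subsemigroup S) < T :=
    bot_lt_iff_ne_bot.2 ((coe_nonempty_iff_ne_bot T).1 ⟨x, hx⟩)
  have := natHeight_strictMono h
  omega

theorem exists_mem_of_natHeight_pos {S : Type*} [Semigroup S] {T : Subsemigroup S} (h : 0 < natHeight T) : ∃ x, x ∈ T :=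
  (coe_nonempty_iff_ne_bot T).2 fun h' => by simp [h', natHeight_bot] at h

theorem maxHeight_top (hS : IsCompletelyRegular S) (x : S) :
    maxHeight hS (twoSidedIdeal x) ⊤ = natHeight (hClass hS x) := by
  obtain ⟨y, hy, h⟩ := exists_maxHeight_eq hS ⊤ (rfl : twoSidedIdeal x = _)
  rw [h, top_inf_eq, natHeight_hClass_eq hS hy]

/-- The number of classes of `f` that meet the part of `T` in the `J`-class of `j`. -/
noncomputable def classCount (f : S → Set S) (j : Set S) (T : Subsemigroup S) : ℕ :=
  (f '' {x | x ∈ T ∧ twoSidedIdeal x = j}).ncard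

theorem classCount_mono (f : S → Set S) (j : Set S) : Monotone (classCount f j) :=
  fun _ _ h => Set.ncard_le_ncard (Set.image_mono fun _ hx => ⟨h hx.1, hx.2⟩)

theorem classCount_pos (f : S → Set S) {j : Set S} {T : Subsemigroup S} {x : S} (hx : x ∈ T)
    (hj : twoSidedIdeal x = j) : 0 < classCount f j T :=
  (Set.ncard_pos).2 ⟨_, x, ⟨hx, hj⟩, rfl⟩

theorem classCount_lt {f : S → Set S} {j : Set S} {T T' : Subsemigroup S} (h : T ≤ T') {x : S}
    (hx : x ∈ T') (hj : twoSidedIdeal x = j)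
    (hf : f x ∉ f '' {x | x ∈ T ∧ twoSidedIdeal x = j}) : classCount f j T < classCount f j T' := by
  refine Set.ncard_lt_ncard ?_
  refine ⟨Set.image_mono fun _ hx => ⟨h hx.1, hx.2⟩, fun hge => hf (hge ⟨x, ⟨hx, hj⟩, rfl⟩)⟩

/-- The contribution of the `J`-class of `j` to the height of `T`. -/
noncomputable def rank (hS : IsCompletelyRegular S) (j : Set S) (T : Subsemigroup S) : ℕ :=
  (classCount leftIdeal j T - 1) + (classCount rightIdeal j T - 1) + maxHeight hS j T

theorem rank_mono (hS : IsCompletelyRegular S) (j : Set S) : Monotone (rank hS j) := by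
  intro T T' h
  have h1 := classCount_mono leftIdeal j h
  have h2 := classCount_mono rightIdeal j h
  have h3 := maxHeight_mono hS j h
  unfold rank
  omega

theorem rank_lt (hS : IsCompletelyRegular S) {j : Set S} {T T' : Subsemigroup S} (h : T ≤ T')
    {x : S} (hx : x ∈ T') (hxT : x ∉ T) (hj : twoSidedIdeal x = j) :
    rank hS j T < rank hS j T' := by
  have h1 := classCount_mono leftIdeal j h
  have h2 := classCount_mono rightIdeal j h
  have h3 := maxHeight_mono hS j h
  obtain ⟨y, hy, hmax⟩ := exists_maxHeight_eq hS T hj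
  unfold rank
  by_cases hne : ∃ z ∈ T, twoSidedIdeal z = j
  · obtain ⟨z, hz, hzj⟩ := hne
    -- Positive counts make the truncated subtractions in `rank` genuine, so one extra class raises
    -- the rank.
    have h4 := classCount_pos leftIdeal hz hzj
    have h5 := classCount_pos rightIdeal hz hzj
    by_cases hL : leftIdeal x ∈ leftIdeal '' {x | x ∈ T ∧ twoSidedIdeal x = j}
    · by_cases hR : rightIdeal x ∈ rightIdeal '' {x | x ∈ T ∧ twoSidedIdeal x = j}
      · obtain ⟨b, ⟨hb, -⟩, hbx⟩ := hL
        obtain ⟨a, ⟨ha, -⟩, hax⟩ := hR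
        have hpos : 0 < natHeight (T ⊓ hClass hS y) :=
          hmax ▸ (natHeight_pos (⟨hz, mem_hClass_self hS z⟩ : z ∈ T ⊓ hClass hS z)).trans_le
            (natHeight_inf_le_maxHeight hS T hzj)
        obtain ⟨w, hw, hwy⟩ := exists_mem_of_natHeight_pos hpos
        have h6 := natHeight_strictMono
          (inf_hClass_lt hS h hx hxT ha hax hb hbx hw hwy (hy.trans hj.symm))
        have h7 := natHeight_inf_le_maxHeight hS T' hy
        omega
      · have := classCount_lt h hx hj hR
        omega
    · have := classCount_lt h hx hj hL
      omega
  · have h4 : maxHeight hS j T = 0 := by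
      by_contra h0
      obtain ⟨w, hw, hwy⟩ := exists_mem_of_natHeight_pos (hmax ▸ Nat.pos_of_ne_zero h0)
      exact hne ⟨w, hw, (twoSidedIdeal_eq_of_leftIdeal_eq (mem_hClass.1 hwy).1).trans hy⟩
    have h5 : 0 < natHeight (T' ⊓ hClass hS x) := natHeight_pos ⟨hx, mem_hClass_self hS x⟩
    have h6 := natHeight_inf_le_maxHeight hS T' hj
    omega

/-- The set of principal two-sided ideals, which parametrizes the `J`-classes. -/
noncomputable def twoSidedIdeals (S : Type*) [Semigroup S] [Finite S] : Finset (Set S) :=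
  (Set.toFinite (Set.range (twoSidedIdeal (S := S)))).toFinset

theorem mem_twoSidedIdeals {j : Set S} : j ∈ twoSidedIdeals S ↔ ∃ x, twoSidedIdeal x = j := by
  simp [twoSidedIdeals]

theorem natHeight_top_le (hS : IsCompletelyRegular S) :
    natHeight (⊤ : Subsemigroup S) ≤ ∑ j ∈ twoSidedIdeals S, rank hS j ⊤ := by
  refine natHeight_le_of_strictMonoOn (f := fun T => ∑ j ∈ twoSidedIdeals S, rank hS j T) ?_
  intro T _ T' _ h
  obtain ⟨x, hx, hxT⟩ := SetLike.exists_of_lt h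
  exact Finset.sum_lt_sum (fun j _ => rank_mono hS j h.le)
    ⟨_, mem_twoSidedIdeals.2 ⟨x, rfl⟩, rank_lt hS h.le hx hxT rfl⟩

/-! ### Lower bound: chains of rectangles and ideals -/

theorem rectangle_mono {S : Type*} [Semigroup S] (hS : IsCompletelyRegular S) (j : Set S) {A A' B B' : Set (Set S)}
    (hA : A ⊆ A') (hB : B ⊆ B') : rectangle hS j A B ≤ rectangle hS j A' B' :=
  fun _ hx => ⟨hx.1, hA hx.2.1, hB hx.2.2⟩

theorem rectangle_lt {S : Type*} [Semigroup S] (hS : IsCompletelyRegular S) {x y : S} {A A' B B' : Set (Set S)}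
    (hA : A ⊆ A') (hB : B ⊆ B') (hxy : twoSidedIdeal y = twoSidedIdeal x)
    (hx : leftIdeal x ∈ A') (hy : rightIdeal y ∈ B') (h : leftIdeal x ∉ A ∨ rightIdeal y ∉ B) :
    rectangle hS (twoSidedIdeal x) A B < rectangle hS (twoSidedIdeal x) A' B' := by
  obtain ⟨h1, h2, h3⟩ := green_mul hS hxy
  refine lt_of_le_not_ge (rectangle_mono hS _ hA hB) fun hge => ?_
  -- The product has the L-class of `x` and the R-class of `y`, so it separates the rectangles.
  have := @hge (y * x) ⟨h1, h2 ▸ hx, h3 ▸ hy⟩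
  rw [mem_rectangle, h2, h3] at this
  tauto

theorem natHeight_rectangle_left (hS : IsCompletelyRegular S) {y : S} {B : Set (Set S)}
    (hy : rightIdeal y ∈ B) (A₀ : Set (Set S)) (A : Finset (Set S))
    (hA : ∀ a ∈ A, ∃ x, twoSidedIdeal x = twoSidedIdeal y ∧ leftIdeal x = a)
    (hA₀ : ∀ a ∈ A, a ∉ A₀) :
    natHeight (rectangle hS (twoSidedIdeal y) A₀ B) + A.card ≤
      natHeight (rectangle hS (twoSidedIdeal y) (A₀ ∪ A) B) := by
  classical
  induction A using Finset.induction_on with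
  | empty => simp
  | insert a A ha ih =>
    specialize ih (fun b hb => hA b (Finset.mem_insert_of_mem hb))
      fun b hb => hA₀ b (Finset.mem_insert_of_mem hb)
    obtain ⟨x, hxy, rfl⟩ := hA a (Finset.mem_insert_self _ _)
    have hx := hA₀ _ (Finset.mem_insert_self (leftIdeal x) A)
    have hlt := rectangle_lt hS (x := x) (A := A₀ ∪ A) (A' := A₀ ∪ ↑(insert (leftIdeal x) A))
      (Set.union_subset_union_right _ (by simp)) (subset_refl B) hxy.symm (by simp) hy
      (Or.inl (by simp [hx, ha]))
    have := natHeight_strictMono hlt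
    rw [Finset.card_insert_of_notMem ha]
    rw [hxy] at this
    omega

theorem natHeight_rectangle_right (hS : IsCompletelyRegular S) {x : S} {A : Set (Set S)}
    (hx : leftIdeal x ∈ A) (B₀ : Set (Set S)) (B : Finset (Set S))
    (hB : ∀ b ∈ B, ∃ y, twoSidedIdeal y = twoSidedIdeal x ∧ rightIdeal y = b)
    (hB₀ : ∀ b ∈ B, b ∉ B₀) :
    natHeight (rectangle hS (twoSidedIdeal x) A B₀) + B.card ≤
      natHeight (rectangle hS (twoSidedIdeal x) A (B₀ ∪ B)) := by
  classical
  induction B using Finset.induction_on with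
  | empty => simp
  | insert b B hb ih =>
    specialize ih (fun c hc => hB c (Finset.mem_insert_of_mem hc))
      fun c hc => hB₀ c (Finset.mem_insert_of_mem hc)
    obtain ⟨y, hyx, rfl⟩ := hB b (Finset.mem_insert_self _ _)
    have hy := hB₀ _ (Finset.mem_insert_self (rightIdeal y) B)
    have hlt := rectangle_lt hS (y := y) (B := B₀ ∪ B) (B' := B₀ ∪ ↑(insert (rightIdeal y) B))
      (subset_refl A) (Set.union_subset_union_right _ (by simp)) hyx hx (by simp)
      (Or.inr (by simp [hy, hb]))
    have := natHeight_strictMono hlt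
    rw [Finset.card_insert_of_notMem hb]
    omega

/-- The chain grows from the H-class of `x` to its whole R-class, one L-class at a time, and from
there to the J-class, one R-class at a time. -/
theorem rank_top_le_natHeight (hS : IsCompletelyRegular S) (x : S) :
    rank hS (twoSidedIdeal x) ⊤ ≤
      natHeight (rectangle hS (twoSidedIdeal x) Set.univ Set.univ) := by
  have hcard : ∀ f : S → Set S, classCount f (twoSidedIdeal x) ⊤ - 1 =
      (Set.toFinite (f '' {y | twoSidedIdeal y = twoSidedIdeal x} \ {f x})).toFinset.card := by
    intro f
    have hx : f x ∈ f '' {y | twoSidedIdeal y = twoSidedIdeal x} := ⟨x, rfl, rfl⟩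
    rw [← Set.ncard_eq_toFinset_card, Set.ncard_sdiff_singleton_of_mem hx]
    simp [classCount]
  have h1 := natHeight_rectangle_left hS (y := x) (B := {rightIdeal x}) rfl {leftIdeal x}
    (Set.toFinite (leftIdeal '' {y | twoSidedIdeal y = twoSidedIdeal x} \ {leftIdeal x})).toFinset
    (fun a ha => by simp at ha; exact ha.1) (fun a ha => by simp at ha; exact ha.2)
  have h2 := natHeight_rectangle_right hS (x := x) (A := Set.univ) trivial {rightIdeal x}
    (Set.toFinite (rightIdeal '' {y | twoSidedIdeal y = twoSidedIdeal x} \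
      {rightIdeal x})).toFinset
    (fun a ha => by simp at ha; exact ha.1) (fun a ha => by simp at ha; exact ha.2)
  rw [← hcard] at h1 h2
  have h3 := natHeight_strictMono.monotone
    (rectangle_mono hS (twoSidedIdeal x) (B := {rightIdeal x}) (Set.subset_univ
      ({leftIdeal x} ∪ ((Set.toFinite (leftIdeal '' {y | twoSidedIdeal y = twoSidedIdeal x} \
        {leftIdeal x})).toFinset : Set (Set S)))) subset_rfl)
  have h4 := natHeight_strictMono.monotone
    (rectangle_mono hS (twoSidedIdeal x) (A := Set.univ) subset_rfl (Set.subset_univ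
      ({rightIdeal x} ∪ ((Set.toFinite (rightIdeal '' {y | twoSidedIdeal y = twoSidedIdeal x} \
        {rightIdeal x})).toFinset : Set (Set S)))))
  rw [rank, maxHeight_top, hClass]
  omega

theorem sum_natHeight_le_of_lower (hS : IsCompletelyRegular S) (n : ℕ) :
    ∀ A : Finset (Set S), A.card = n → (∀ j ∈ A, ∀ y : S, twoSidedIdeal y ⊆ j →
      twoSidedIdeal y ∈ A) → ∃ U : Subsemigroup S, (∀ x, x ∈ U ↔ twoSidedIdeal x ∈ A) ∧
      ∑ j ∈ A, natHeight (rectangle hS j Set.univ Set.univ) ≤ natHeight U := by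
  classical
  induction n with
  | zero =>
    intro A hA _
    rw [Finset.card_eq_zero] at hA
    exact ⟨⊥, by simp [hA, Subsemigroup.notMem_bot], by simp [hA]⟩
  | succ n ih =>
    intro A hA hlow
    -- Removing a maximal J-class leaves a lower set, whose union `U` is an ideal; hence `U`
    -- together with any subsemigroup is again a subsemigroup.
    obtain ⟨j, hj⟩ := A.exists_maximal (Finset.card_pos.1 (by omega))
    obtain ⟨U, hU, hsum⟩ := ih (A.erase j) (by rw [Finset.card_erase_of_mem hj.1, hA]; rfl) (by
      intro k hk y hy
      obtain ⟨hkj, hkA⟩ := Finset.mem_erase.1 hk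
      refine Finset.mem_erase.2 ⟨?_, hlow k hkA y hy⟩
      rintro rfl
      exact hkj (le_antisymm (hj.2 hkA hy) hy))
    have hUl : ∀ x y, y ∈ U → x * y ∈ U := fun x y hy => by
      rw [hU, Finset.mem_erase] at hy ⊢
      refine ⟨?_, hlow _ hy.2 _ (twoSidedIdeal_mul_subset_right _ _)⟩
      intro h
      exact hy.1 (le_antisymm (hj.2 hy.2 (h ▸ twoSidedIdeal_mul_subset_right _ _))
        (h ▸ twoSidedIdeal_mul_subset_right _ _))
    have hUr : ∀ x y, x ∈ U → x * y ∈ U := fun x y hx => by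
      rw [hU, Finset.mem_erase] at hx ⊢
      refine ⟨?_, hlow _ hx.2 _ (twoSidedIdeal_mul_subset_left _ _)⟩
      intro h
      exact hx.1 (le_antisymm (hj.2 hx.2 (h ▸ twoSidedIdeal_mul_subset_left _ _))
        (h ▸ twoSidedIdeal_mul_subset_left _ _))
    let f : Subsemigroup S → Subsemigroup S := fun T =>
      { carrier := {x | x ∈ U ∨ x ∈ T}
        mul_mem' := by
          rintro x y (hx | hx) (hy | hy)
          · exact Or.inl (hUl _ _ hy)
          · exact Or.inl (hUr _ _ hx)
          · exact Or.inl (hUl _ _ hy)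
          · exact Or.inr (mul_mem hx hy) }
    have hf : StrictMonoOn f (Set.Iic (rectangle hS j Set.univ Set.univ)) := by
      intro T _ T' hT' h
      refine lt_of_le_not_ge (fun x hx => hx.imp id fun hx => h.le hx) fun hge => h.not_ge ?_
      intro x hx
      refine (@hge x (Or.inr hx)).resolve_left fun hxU => ?_
      exact (Finset.mem_erase.1 ((hU x).1 hxU)).1 (hT' hx).1
    have hbot : U ≤ f ⊥ := fun x hx => Or.inl hx
    have h1 := natHeight_strictMono.monotone hbot
    have h2 := natHeight_add_le hf
    refine ⟨f (rectangle hS j Set.univ Set.univ), fun x => ?_, ?_⟩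
    · show x ∈ U ∨ x ∈ rectangle hS j Set.univ Set.univ ↔ _
      rw [hU, mem_rectangle, Finset.mem_erase]
      constructor
      · rintro (h | h)
        · exact h.2
        · exact h.1 ▸ hj.1
      · intro h
        by_cases hx : twoSidedIdeal x = j
        · exact Or.inr ⟨hx, trivial, trivial⟩
        · exact Or.inl ⟨hx, h⟩
    · rw [← Finset.add_sum_erase A _ hj.1]
      omega

theorem natHeight_top_eq_sum (hS : IsCompletelyRegular S) :
    natHeight (⊤ : Subsemigroup S) = ∑ j ∈ twoSidedIdeals S, rank hS j ⊤ := by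
  refine (natHeight_top_le hS).antisymm ?_
  obtain ⟨U, -, hU⟩ := sum_natHeight_le_of_lower hS _ (twoSidedIdeals S) rfl
    fun _ _ y _ => mem_twoSidedIdeals.2 ⟨y, rfl⟩
  refine le_trans (Finset.sum_le_sum fun j hj => ?_)
    (hU.trans (natHeight_strictMono.monotone le_top))
  obtain ⟨x, rfl⟩ := mem_twoSidedIdeals.1 hj
  exact rank_top_le_natHeight hS x

/-! ### Counting classes and assembling the formula -/

theorem ncard_classes_ker {α β : Type*} (f : α → β) :
    (Setoid.ker f).classes.ncard = (Set.range f).ncard := by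
  have h : (Setoid.ker f).classes = (fun b => f ⁻¹' {b}) '' Set.range f := by
    ext c
    constructor
    · rintro ⟨y, rfl⟩
      exact ⟨f y, ⟨y, rfl⟩, rfl⟩
    · rintro ⟨_, ⟨y, rfl⟩, rfl⟩
      exact ⟨y, rfl⟩
  rw [h, Set.InjOn.ncard_image]
  rintro _ ⟨x, rfl⟩ b - h
  exact (Set.ext_iff.1 h x).1 rfl

/-- Each class of `f` lies in a single J-class, so the counts over distinct J-classes do not
overlap. -/
theorem sum_classCount_eq {f : S → Set S}
    (hf : ∀ x y, f x = f y → twoSidedIdeal x = twoSidedIdeal y) :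
    ∑ j ∈ twoSidedIdeals S, classCount f j ⊤ = (Set.range f).ncard := by
  classical
  have h : (Set.toFinite (Set.range f)).toFinset = (twoSidedIdeals S).biUnion fun j =>
      (Set.toFinite (f '' {x | x ∈ (⊤ : Subsemigroup S) ∧ twoSidedIdeal x = j})).toFinset := by
    ext a
    simp only [Set.Finite.mem_toFinset, Finset.mem_biUnion]
    constructor
    · rintro ⟨x, rfl⟩
      exact ⟨_, mem_twoSidedIdeals.2 ⟨x, rfl⟩, x, ⟨trivial, rfl⟩, rfl⟩
    · rintro ⟨_, -, x, -, rfl⟩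
      exact ⟨x, rfl⟩
  rw [Set.ncard_eq_toFinset_card _ (Set.toFinite _), h, Finset.card_biUnion]
  · exact Finset.sum_congr rfl fun j _ => Set.ncard_eq_toFinset_card _ (Set.toFinite _)
  · intro j _ k _ hjk
    rw [Function.onFun, Finset.disjoint_left]
    intro a ha hb
    simp only [Set.Finite.mem_toFinset] at ha hb
    obtain ⟨x, ⟨-, rfl⟩, rfl⟩ := ha
    obtain ⟨y, ⟨-, rfl⟩, h⟩ := hb
    exact hjk (hf _ _ h.symm)

theorem length_eq_sum_maxHeight (hS : IsCompletelyRegular S) :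
    length S = ((greenL S).classes.ncard : ℤ) + (greenR S).classes.ncard
      - 2 * (twoSidedIdeals S).card - 1 + ∑ j ∈ twoSidedIdeals S, (maxHeight hS j ⊤ : ℤ) := by
  have hrank : ∀ j ∈ twoSidedIdeals S, (rank hS j ⊤ : ℤ) =
      (classCount leftIdeal j ⊤ : ℤ) + classCount rightIdeal j ⊤ - 2 + maxHeight hS j ⊤ := by
    intro j hj
    obtain ⟨x, hx⟩ := mem_twoSidedIdeals.1 hj
    have h1 := classCount_pos leftIdeal (T := ⊤) trivial hx
    have h2 := classCount_pos rightIdeal (T := ⊤) trivial hx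
    unfold rank
    omega
  rw [length_eq_natHeight_top, natHeight_top_eq_sum hS, greenL, greenR, ncard_classes_ker,
    ncard_classes_ker, ← sum_classCount_eq fun _ _ => twoSidedIdeal_eq_of_leftIdeal_eq,
    ← sum_classCount_eq fun _ _ => twoSidedIdeal_eq_of_rightIdeal_eq]
  push_cast
  rw [Finset.sum_congr rfl hrank]
  simp only [Finset.sum_add_distrib, Finset.sum_sub_distrib, Finset.sum_const, nsmul_eq_mul]
  ring

theorem IsBand.isCompletelyRegular {S : Type*} [Semigroup S] (hS : IsBand S) :
    IsCompletelyRegular S := fun x =>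
  ⟨{ carrier := {x}, mul_mem' := by rintro _ _ rfl rfl; exact hS _ },
    ⟨x, rfl, by rintro _ rfl; exact ⟨hS _, hS _⟩, by rintro _ rfl; exact ⟨_, rfl, hS _, hS _⟩⟩, rfl⟩

theorem IsBand.natHeight_hClass (hS : IsBand S) (x : S) :
    natHeight (hClass hS.isCompletelyRegular x) = 1 := by
  have hpos := natHeight_pos (mem_hClass_self hS.isCompletelyRegular x)
  obtain ⟨n, hn⟩ : ∃ n, natHeight (hClass hS.isCompletelyRegular x) = n + 1 :=
    ⟨_, (Nat.sub_add_cancel hpos).symm⟩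
  obtain ⟨T, hT, hTn⟩ := exists_lt_natHeight_eq hn
  rcases Nat.eq_zero_or_pos n with rfl | h
  · exact hn
  · obtain ⟨y, hy⟩ := exists_mem_of_natHeight_pos (hTn ▸ h)
    -- In a band an H-class has only one element, so a nonempty `T` inside it cannot be proper.
    refine absurd (fun z hz => ?_) hT.not_ge
    rw [eq_of_idempotent_of_mem_hClass (hS x) (hS z) hz,
      ← eq_of_idempotent_of_mem_hClass (hS x) (hS y) (hT.le hy)]
    exact hy

end Rank

end FiniteSemigroup

/-! ### The length formula -/

theorem mainTheorem8 {S : Type*} [Semigroup S] [Finite S] :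
    (FiniteSemigroup.IsCompletelyRegular S →
      ∀ (m n r : ℕ),
        (FiniteSemigroup.greenL S).classes.ncard = m →
        (FiniteSemigroup.greenR S).classes.ncard = n →
        ∀ J : Fin r → Set S, Function.Injective J →
          Set.range J = (FiniteSemigroup.greenJ S).classes →
        ∀ G : Fin r → Subsemigroup S,
          (∀ i, FiniteSemigroup.IsMaximalSubgroup (G i) ∧ (G i : Set S) ⊆ J i) →
        FiniteSemigroup.length S
          = (m : ℤ) + n - r - 1 + ∑ i, FiniteSemigroup.length (G i)) ∧
    (FiniteSemigroup.IsBand S →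
      ∀ (m n r : ℕ),
        (FiniteSemigroup.greenL S).classes.ncard = m →
        (FiniteSemigroup.greenR S).classes.ncard = n →
        (FiniteSemigroup.greenJ S).classes.ncard = r →
        FiniteSemigroup.length S = (m : ℤ) + n - r - 1) := by
  classical
  open FiniteSemigroup in
  refine ⟨?_, ?_⟩
  · rintro hS m n r rfl rfl J hJ hrange G hG
    choose e heG hGe using fun i => (hG i).1.eq_hClass hS
    have hclass : ∀ i, J i = {y | twoSidedIdeal y = twoSidedIdeal (e i)} := by
      intro i
      have hmem : J i ∈ (greenJ S).classes := hrange ▸ Set.mem_range_self i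
      exact Setoid.eq_of_mem_classes hmem ((hG i).2 (heG i))
        ((greenJ S).mem_classes (e i)) rfl
    have himage : twoSidedIdeals S = Finset.univ.image fun i => twoSidedIdeal (e i) := by
      ext j
      rw [mem_twoSidedIdeals, Finset.mem_image]
      constructor
      · rintro ⟨x, rfl⟩
        obtain ⟨i, hi⟩ : {y | twoSidedIdeal y = twoSidedIdeal x} ∈ Set.range J :=
          hrange ▸ (greenJ S).mem_classes x
        have hei := (hG i).2 (heG i)
        rw [hi] at hei
        exact ⟨i, Finset.mem_univ i, hei⟩
      · rintro ⟨i, -, rfl⟩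
        exact ⟨_, rfl⟩
    have hinj : Function.Injective fun i => twoSidedIdeal (e i) := by
      intro i k h
      apply hJ
      rw [hclass, hclass, show twoSidedIdeal (e i) = twoSidedIdeal (e k) from h]
    -- The `+ 1` restores the empty subsemigroup dropped by `length`; summed over the J-classes it
    -- turns `-2r` into `-r`.
    have hlen : ∀ i, (maxHeight hS (twoSidedIdeal (e i)) ⊤ : ℤ) = length (G i) + 1 := by
      intro i
      rw [maxHeight_top, ← hGe i, length_coe_eq_natHeight]
      ring
    rw [length_eq_sum_maxHeight hS, himage, Finset.card_image_of_injective _ hinj,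
      Finset.sum_image hinj.injOn, Finset.sum_congr rfl fun i _ => hlen i, Finset.sum_add_distrib]
    simp only [Finset.card_univ, Fintype.card_fin, Finset.sum_const, nsmul_eq_mul]
    ring
  · rintro hS m n r rfl rfl rfl
    have hone : ∀ j ∈ twoSidedIdeals S, (maxHeight hS.isCompletelyRegular j ⊤ : ℤ) = 1 := by
      intro j hj
      obtain ⟨x, rfl⟩ := mem_twoSidedIdeals.1 hj
      rw [maxHeight_top, hS.natHeight_hClass, Nat.cast_one]
    have hcard : (greenJ S).classes.ncard = (twoSidedIdeals S).card := by
      rw [greenJ, ncard_classes_ker, Set.ncard_eq_toFinset_card _ (Set.toFinite _)]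
      rfl
    rw [length_eq_sum_maxHeight hS.isCompletelyRegular, Finset.sum_congr rfl hone, hcard]
    simp only [Finset.sum_const, nsmul_eq_mul]
    ring
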